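/- All manifolds are real, finite-dimensional, smooth, Hausdorff, second countable and without boundary; all maps are smooth. Let $Q$ be such a manifold and $L\in C^\infty(TQ)$ a Lagrangian, with vertical endomorphism $S$ and Liouville field $\Delta$ on $TQ$; put $\theta_L=dL\circ S$, $\omega_L=-d\theta_L$, $E_L=\Delta(L)-L$, and let $FL\colon TQ\to T^*Q$ be the Legendre transformation (the fibre derivative of $L$). Let $\omega=-d\theta$ be the canonical symplectic form of $T^*Q$. $L$ is regular if $FL$ is a local diffeomorphism, and hyperregular if $FL$ is a diffeomorphism. Denote by $\Gamma_L$ the solution of $i(\Gamma_L)\omega_L=dE_L$ and, for a Hamiltonian $H$, by $Z_H$ the solution of $i(Z_H)\omega=dH$. A vector field $X$ on $Q$ solves the generalized Lagrangian Hamilton–Jacobi problem if for every integral curve $\gamma\colon I\to Q$ of $X$ ($I\subseteq\mathbb R$ an open interval), $X\circ\gamma$ is an integral curve of $\Gamma_L$; it solves the Lagrangian Hamilton–Jacobi problem if in addition $X^*\omega_L=0$. A couple $(X,\alpha)$ of a vector field and a $1$-form on $Q$ solves the generalized Hamiltonian Hamilton–Jacobi problem for $H$ if for every integral curve $\gamma\colon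 I\to Q$ of $X$, $\alpha\circ\gamma$ is an integral curve of $Z_H$; it solves the Hamiltonian Hamilton–Jacobi problem if in addition $d\alpha=0$. One says that $\alpha$ solves either problem if $(X,\alpha)$ does for some $X$. **Theorem.** (a) Let $L$ be hyperregular and let $H=E_L\circ FL^{-1}$ be the associated Hamiltonian on $T^*Q$. If $(X,\alpha)$ is a solution to the generalized Hamiltonian Hamilton–Jacobi problem (respectively, to the Hamiltonian Hamilton–Jacobi problem), then $X=FL^{-1}\circ\alpha$, and $X$ is a solution to the generalized Lagrangian Hamilton–Jacobi problem (respectively, to the Lagrangian Hamilton–Jacobi problem). Conversely, if $X$ is a solution to the generalized Lagrangian (respectively, the Lagrangian) Hamilton–Jacobi problem, then, with $\alpha=FL\circ X$, the couple $(X,\alpha)$ is a solution to the generalized Hamiltonian (respectively, the Hamiltonian) Hamilton–Jacobi problem. (b) Let $L$ be regular. Let $W\subseteq TQ$ and $V\subseteq T^*Q$ be open sets such that $FL$ restricts to a diffeomorphism $\Phi\colon W\to V$, let $H=E_L\circ\Phi^{-1}$ be the associated Hamiltonian on $V$, and let $U\subseteq Q$ be open. Then the same statements hold for vector fields $X$ and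 $1$-forms $\alpha$ on $U$ with $X(U)\subseteq W$ in the converse and $\alpha(U)\subseteq V$ in the direct part, with $FL^{-1}$ replaced by $\Phi^{-1}$ and with integral curves in $U$. -/

import Mathlib

open Set Manifold Bundle
open scoped Manifold ContDiff Topology

noncomputable section

namespace HamiltonJacobi

section ExteriorCalculus

variable {F : Type*} [NormedAddCommGroup F] [NormedSpace ℝ F]
  {K : Type*} [TopologicalSpace K] (J : ModelWithCorners ℝ F K)
  {N : Type*} [TopologicalSpace N] [ChartedSpace K N]

/-- The expression of a differential `1`-form `θ` in the preferred chart around `x`: the pullback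
of `θ` by the inverse of the chart, a `1`-form on the model vector space. -/
def chartOneForm (θ : ∀ x : N, TangentSpace J x →L[ℝ] ℝ) (x : N) (y : F) : F [⋀^Fin 1]→L[ℝ] ℝ :=
  ContinuousAlternatingMap.ofSubsingleton ℝ F ℝ (0 : Fin 1)
    ((θ ((extChartAt J x).symm y)).comp (mfderiv 𝓘(ℝ, F) J (extChartAt J x).symm y))

/-- The exterior derivative `dθ` of a `1`-form on a manifold without boundary, computed in the
preferred chart around each point: `dθ(u, v) = D_u θ (v) - D_v θ (u)` in that chart. -/
def extDerivOneForm (θ : ∀ x : N, TangentSpace J x →L[ℝ] ℝ) (x : N) (u v : TangentSpace J x) : ℝ :=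
  extDeriv (chartOneForm J θ x) (extChartAt J x x)
    ![mfderiv J 𝓘(ℝ, F) (extChartAt J x) x u, mfderiv J 𝓘(ℝ, F) (extChartAt J x) x v]

/-- The vector field `Z` solving the dynamical equation `i(Z) Ω = df`; for nondegenerate `Ω`
on a finite-dimensional manifold, `Z p` is the unique vector with
`Ω_p (Z p, w) = df_p (w)` for all `w`. -/
def dynamicalField (Ω : ∀ p : N, TangentSpace J p → TangentSpace J p → ℝ) (f : N → ℝ) (p : N) :
    TangentSpace J p :=
  Classical.epsilon fun z : TangentSpace J p =>
    ∀ w : TangentSpace J p, Ω p z w = (mfderiv J 𝓘(ℝ, ℝ) f p w : ℝ)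

end ExteriorCalculus

variable {E : Type*} [NormedAddCommGroup E] [NormedSpace ℝ E]
  {Q : Type*} [TopologicalSpace Q] [ChartedSpace E Q] [IsManifold 𝓘(ℝ, E) ∞ Q]

variable (E Q) in
/-- The tangent bundle `TQ`. -/
abbrev TQ : Type _ := TangentBundle 𝓘(ℝ, E) Q

/-- The cotangent space `T*_q Q`. -/
abbrev CotangentSpace (E : Type*) [NormedAddCommGroup E] [NormedSpace ℝ E]
    {Q : Type*} [TopologicalSpace Q] [ChartedSpace E Q] (q : Q) : Type _ :=
  TangentSpace 𝓘(ℝ, E) q →L[ℝ] Bundle.Trivial Q ℝ q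

variable (E Q) in
/-- The cotangent bundle `T*Q`. -/
abbrev CoTQ : Type _ := TotalSpace (E →L[ℝ] ℝ) (CotangentSpace E : Q → Type _)

variable (E) in
/-- The model with corners of the cotangent bundle. -/
abbrev coModel : ModelWithCorners ℝ (E × (E →L[ℝ] ℝ)) (ModelProd E (E →L[ℝ] ℝ)) :=
  𝓘(ℝ, E).prod 𝓘(ℝ, E →L[ℝ] ℝ)

/-- The point `α(q)` of `T*Q`. -/
abbrev coPt (q : Q) (a : CotangentSpace E q) : CoTQ E Q := TotalSpace.mk' (E →L[ℝ] ℝ) q a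

/-- The point `X(q)` of `TQ`. -/
abbrev tPt (q : Q) (v : TangentSpace 𝓘(ℝ, E) q) : TQ E Q := TotalSpace.mk' E q v

/-! ### Hamiltonian side -/

/-- The tautological `1`-form of `T*Q`: `θ_p (w) = p (Tπ_Q w)`. -/
def tautologicalForm (p : CoTQ E Q) : TangentSpace (coModel E) p →L[ℝ] ℝ :=
  ContinuousLinearMap.comp (p.2 : TangentSpace 𝓘(ℝ, E) p.1 →L[ℝ] ℝ)
    (mfderiv (coModel E) 𝓘(ℝ, E) (fun z : CoTQ E Q => z.1) p)

/-- The canonical symplectic form `ω = -dθ` of `T*Q`. -/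
def canonicalForm (p : CoTQ E Q) (u v : TangentSpace (coModel E) p) : ℝ :=
  -extDerivOneForm (coModel E) tautologicalForm p u v

/-- The Hamiltonian vector field `Z_H`: `i(Z_H) ω = dH`. -/
def hamiltonianField (H : CoTQ E Q → ℝ) : ∀ p : CoTQ E Q, TangentSpace (coModel E) p :=
  dynamicalField (coModel E) canonicalForm H

/-- `X` is a smooth vector field on the open set `U`. -/
def SmoothField (U : Set Q) (X : ∀ q : Q, TangentSpace 𝓘(ℝ, E) q) : Prop :=
  ContMDiffOn 𝓘(ℝ, E) 𝓘(ℝ, E).tangent ∞ (fun q => tPt q (X q)) U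

/-- `α` is a smooth `1`-form on the open set `U`. -/
def SmoothForm (U : Set Q) (α : ∀ q : Q, CotangentSpace E q) : Prop :=
  ContMDiffOn 𝓘(ℝ, E) (coModel E) ∞ (fun q => coPt q (α q)) U

/-- `(X, α)` is a solution, on the open set `U ⊆ Q`, to the generalized Hamiltonian
Hamilton–Jacobi problem for the Hamiltonian function `H`: for every integral curve `γ` of `X`,
defined on an open interval, `α ∘ γ` is an integral curve of `Z_H`. The function `H` only matters
near the points `α(q)`, `q ∈ U`. -/
structure GenHamHJ (H : CoTQ E Q → ℝ) (U : Set Q) (X : ∀ q : Q, TangentSpace 𝓘(ℝ, E) q)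
    (α : ∀ q : Q, CotangentSpace E q) : Prop where
  smooth_field : SmoothField U X
  smooth_form : SmoothForm U α
  integral_curves : ∀ (I : Set ℝ) (γ : ℝ → Q), IsOpen I → I.OrdConnected → MapsTo γ I U →
    IsMIntegralCurveOn (I := 𝓘(ℝ, E)) γ X I →
    IsMIntegralCurveOn (I := coModel E) (fun t => coPt (γ t) (α (γ t))) (hamiltonianField H) I

/-- `α`, with associated vector field `X`, is a solution, on the open set `U ⊆ Q`, to the
Hamiltonian Hamilton–Jacobi problem: it is a solution to the generalized problem and `dα = 0`. -/
structure HamHJ (H : CoTQ E Q → ℝ) (U : Set Q) (X : ∀ q : Q, TangentSpace 𝓘(ℝ, E) q)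
    (α : ∀ q : Q, CotangentSpace E q) : Prop extends GenHamHJ H U X α where
  closed : ∀ q ∈ U, ∀ u v : TangentSpace 𝓘(ℝ, E) q, extDerivOneForm 𝓘(ℝ, E) α q u v = 0

/-! ### Lagrangian side -/

/-- The vertical lift `T_q Q → T_v (TQ)` at `v ∈ T_q Q`: the derivative at `v` of the inclusion
of the fibre `T_q Q` (which is the model vector space) into `TQ`. -/
def verticalLift (v : TQ E Q) : TangentSpace 𝓘(ℝ, E) v.1 →L[ℝ] TangentSpace 𝓘(ℝ, E).tangent v :=
  mfderiv 𝓘(ℝ, E) 𝓘(ℝ, E).tangent (fun w : E => (tPt v.1 w : TQ E Q)) (v.2 : E)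

/-- The vertical endomorphism `S` of `T(TQ)`: the vertical lift of the projection `Tτ_Q`. -/
def verticalEndo (v : TQ E Q) :
    TangentSpace 𝓘(ℝ, E).tangent v →L[ℝ] TangentSpace 𝓘(ℝ, E).tangent v :=
  (verticalLift v).comp (mfderiv 𝓘(ℝ, E).tangent 𝓘(ℝ, E) (fun z : TQ E Q => z.1) v)

/-- The Liouville vector field `Δ` on `TQ`. -/
def liouvilleField (v : TQ E Q) : TangentSpace 𝓘(ℝ, E).tangent v :=
  verticalLift v v.2

/-- The differential `dL` of a function on `TQ`. -/
def diffL (L : TQ E Q → ℝ) (v : TQ E Q) : TangentSpace 𝓘(ℝ, E).tangent v →L[ℝ] ℝ :=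
  mfderiv 𝓘(ℝ, E).tangent 𝓘(ℝ, ℝ) L v

/-- The Lagrangian `1`-form `θ_L = dL ∘ S`. -/
def lagrangianOneForm (L : TQ E Q → ℝ) (v : TQ E Q) : TangentSpace 𝓘(ℝ, E).tangent v →L[ℝ] ℝ :=
  (diffL L v).comp (verticalEndo v)

/-- The Lagrangian `2`-form `ω_L = -dθ_L`. -/
def lagrangianForm (L : TQ E Q → ℝ) (v : TQ E Q)
    (x y : TangentSpace 𝓘(ℝ, E).tangent v) : ℝ :=
  -extDerivOneForm 𝓘(ℝ, E).tangent (lagrangianOneForm L) v x y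

/-- The Lagrangian energy `E_L = Δ(L) - L`. -/
def energy (L : TQ E Q → ℝ) (v : TQ E Q) : ℝ :=
  diffL L v (liouvilleField v) - L v

/-- The Lagrangian vector field `Γ_L`: `i(Γ_L) ω_L = dE_L`. -/
def lagrangianField (L : TQ E Q → ℝ) : ∀ v : TQ E Q, TangentSpace 𝓘(ℝ, E).tangent v :=
  dynamicalField 𝓘(ℝ, E).tangent (lagrangianForm L) (energy L)

/-- The derivative at `v` of the restriction of `L` to the fibre `T_q Q`. -/
def fiberDeriv (L : TQ E Q → ℝ) (q : Q) (v : TangentSpace 𝓘(ℝ, E) q) : CotangentSpace E q :=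
  fderiv ℝ (fun w : E => L (tPt q w)) (v : E)

/-- The Legendre transformation `FL : TQ → T*Q`, the fibre derivative of `L`. -/
def legendre (L : TQ E Q → ℝ) (v : TQ E Q) : CoTQ E Q :=
  coPt v.1 (fiberDeriv L v.1 v.2)

/-- `L` is regular: `FL` is a local diffeomorphism. -/
def IsRegularLagrangian (L : TQ E Q → ℝ) : Prop :=
  IsLocalDiffeomorph 𝓘(ℝ, E).tangent (coModel E) ∞ (legendre L)

/-- `X` is a solution, on the open set `U ⊆ Q`, to the generalized Lagrangian Hamilton–Jacobi
problem: for every integral curve `γ` of `X`, defined on an open interval, `X ∘ γ` is an integral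
curve of `Γ_L`. -/
structure GenLagHJ (L : TQ E Q → ℝ) (U : Set Q) (X : ∀ q : Q, TangentSpace 𝓘(ℝ, E) q) :
    Prop where
  smooth_field : SmoothField U X
  integral_curves : ∀ (I : Set ℝ) (γ : ℝ → Q), IsOpen I → I.OrdConnected → MapsTo γ I U →
    IsMIntegralCurveOn (I := 𝓘(ℝ, E)) γ X I →
    IsMIntegralCurveOn (I := 𝓘(ℝ, E).tangent) (fun t => tPt (γ t) (X (γ t))) (lagrangianField L) I

/-- `X` is a solution, on the open set `U ⊆ Q`, to the Lagrangian Hamilton–Jacobi problem: it is a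
solution to the generalized problem and `X^* ω_L = 0`. -/
structure LagHJ (L : TQ E Q → ℝ) (U : Set Q) (X : ∀ q : Q, TangentSpace 𝓘(ℝ, E) q) : Prop
    extends GenLagHJ L U X where
  isotropic : ∀ q ∈ U, ∀ u v : TangentSpace 𝓘(ℝ, E) q,
    lagrangianForm L (tPt q (X q))
      (mfderiv 𝓘(ℝ, E) 𝓘(ℝ, E).tangent (fun z => tPt z (X z)) q u)
      (mfderiv 𝓘(ℝ, E) 𝓘(ℝ, E).tangent (fun z => tPt z (X z)) q v) = 0

end HamiltonJacobi

end

open HamiltonJacobi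

open Set Manifold Bundle
open scoped Manifold ContDiff Topology

noncomputable section

namespace HamiltonJacobi

/-! ### Exterior derivative of a `1`-form under pullback. -/

section Naturality

variable {F : Type*} [NormedAddCommGroup F] [NormedSpace ℝ F]
  {K : Type*} [TopologicalSpace K] {J : ModelWithCorners ℝ F K}
  {N : Type*} [TopologicalSpace N] [ChartedSpace K N]
  {F' : Type*} [NormedAddCommGroup F'] [NormedSpace ℝ F']
  {K' : Type*} [TopologicalSpace K'] {J' : ModelWithCorners ℝ F' K'}
  {N' : Type*} [TopologicalSpace N'] [ChartedSpace K' N']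

/-! The Legendre map covers the identity of `Q`, so it pulls the tautological form back to `θ_L`; by
naturality of `d` it pulls `ω` back to `ω_L`, and `H` back to `E_L` by construction. As `ω` is
nondegenerate and the Legendre map is invertible on the domain considered, it carries `Γ_L` to `Z_H`
(`mfderiv_legendre_lagrangianField`). Hence it carries integral curves `X ∘ γ` of `Γ_L` to integral
curves `α ∘ γ` of `Z_H` and back, as soon as `α = FL ∘ X`.

In the converse part this relation is the definition of `α`. In the direct part it must be deduced,
and `hamiltonianField_legendre_fst` does it: `Z_H` at `FL v` projects to `v`. An integral curve `γ`
of `X` through a given point then has velocity `X` on the one hand and `FL⁻¹ ∘ α` on the other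
(`GenHamHJ.eq_symm`).

For the closed versions, a `1`-form is the pullback of the tautological form by itself, so `X^* ω_L
= α^* ω = -dα` (`lagrangianForm_mfderiv_eq`).

All computations at a point use the preferred chart there, which identifies the tangent spaces of
`TQ` and `T*Q` with `E × E` and `E × E*`; `ω` then has the same constant expression at every point.
-/

lemma extDerivOneForm_eq [IsManifold J ∞ N] (θ : ∀ x : N, TangentSpace J x →L[ℝ] ℝ) (x : N)
    (u v : TangentSpace J x) :
    extDerivOneForm J θ x u v =
      extDeriv (chartOneForm J θ x) (extChartAt J x x) ![(u : F), (v : F)] := by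
  have : IsManifold J 1 N := IsManifold.of_le (n := ∞) (by simp)
  unfold extDerivOneForm
  rw [mfderiv_extChartAt_self]
  rfl

lemma oneForm_apply_congr (θ : ∀ x : N, TangentSpace J x →L[ℝ] ℝ) {a b : N} (h : a = b) (w : F) :
    (θ a : F →L[ℝ] ℝ) w = (θ b : F →L[ℝ] ℝ) w := by
  subst h; rfl

lemma mdifferentiableAt_extChartAt_symm_of_boundaryless [J.Boundaryless] [IsManifold J ∞ N] {x : N}
    {y : F} (hy : y ∈ (extChartAt J x).target) :
    MDifferentiableAt 𝓘(ℝ, F) J (extChartAt J x).symm y := by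
  have : IsManifold J 1 N := IsManifold.of_le (n := ∞) (by simp)
  have := mdifferentiableWithinAt_extChartAt_symm (I := J) hy
  rwa [J.range_eq_univ, mdifferentiableWithinAt_univ] at this

/-- The chart expression of a pulled back form is the pullback of the chart expression. -/
lemma chartOneForm_pullback [J.Boundaryless] [J'.Boundaryless] [IsManifold J ∞ N]
    [IsManifold J' ∞ N'] {f : N → N'} {x : N} (hf : ContMDiffAt J J' ∞ f x)
    {θ' : ∀ x : N, TangentSpace J x →L[ℝ] ℝ} {θ : ∀ x : N', TangentSpace J' x →L[ℝ] ℝ}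
    (h : ∀ᶠ z in 𝓝 x, ∀ w, θ' z w = θ (f z) (mfderiv J J' f z w)) :
    ∀ᶠ y in 𝓝 (extChartAt J x x), chartOneForm J θ' x y =
      (chartOneForm J' θ (f x) (writtenInExtChartAt J J' x f y)).compContinuousLinearMap
        (fderiv ℝ (writtenInExtChartAt J J' x f) y) := by
  have hc : Filter.Tendsto (extChartAt J x).symm (𝓝 (extChartAt J x x)) (𝓝 x) := by
    have := continuousAt_extChartAt_symm (I := J) x
    rwa [ContinuousAt, extChartAt_to_inv x] at this
  have h1 : ∀ᶠ z in 𝓝 x, MDifferentiableAt J J' f z := by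
    have := hf.of_le (m := 1) (by simp)
    filter_upwards [(contMDiffAt_iff_contMDiffAt_nhds (by simp)).1 this] with z hz using
      hz.mdifferentiableAt (by simp)
  have h2 : ∀ᶠ z in 𝓝 x, f z ∈ (extChartAt J' (f x)).source :=
    hf.continuousAt.eventually (extChartAt_source_mem_nhds (f x))
  have hev := hc.eventually (h.and (h1.and h2.eventually_nhds))
  filter_upwards [hev, extChartAt_target_mem_nhds (I := J) x] with y hy hyt
  obtain ⟨hy1, hy2, hy3⟩ := hy
  have hds := mdifferentiableAt_extChartAt_symm_of_boundaryless hyt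
  have hfs : MDifferentiableAt 𝓘(ℝ, F) J' (f ∘ (extChartAt J x).symm) y := hy2.comp y hds
  have hs3 := hy3.self_of_nhds
  have : IsManifold J' 1 N' := IsManifold.of_le (n := ∞) (by simp)
  have hF : MDifferentiableAt 𝓘(ℝ, F) 𝓘(ℝ, F') (writtenInExtChartAt J J' x f) y :=
    MDifferentiableAt.comp (I' := J') y
      (mdifferentiableAt_extChartAt (by simpa using hs3)) hfs
  have hds' : MDifferentiableAt 𝓘(ℝ, F') J' (extChartAt J' (f x)).symm
      (writtenInExtChartAt J J' x f y) :=
    mdifferentiableAt_extChartAt_symm_of_boundaryless ((extChartAt J' (f x)).map_source hs3)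
  have hcy : ContinuousAt (extChartAt J x).symm y := hds.continuousAt
  -- Both composites are `f` read through the chart of the source only. Differentiating this
  -- identity and applying the chain rule to each side compares the two pullbacks.
  have hE : ((extChartAt J' (f x)).symm ∘ writtenInExtChartAt J J' x f) =ᶠ[𝓝 y]
      (f ∘ (extChartAt J x).symm) := by
    filter_upwards [hcy.eventually hy3] with z hz
    exact (extChartAt J' (f x)).left_inv hz
  have hD := hE.mfderiv_eq (I := 𝓘(ℝ, F)) (I' := J')
  have h4 := mfderiv_comp (I := 𝓘(ℝ, F)) (I' := 𝓘(ℝ, F')) (I'' := J') y hds' hF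
  have h5 := mfderiv_comp (I := 𝓘(ℝ, F)) (I' := J) (I'' := J') y hy2 hds
  rw [← mfderiv_eq_fderiv]
  ext w
  have e1 : chartOneForm J θ' x y w = (θ' ((extChartAt J x).symm y))
      (mfderiv 𝓘(ℝ, F) J (extChartAt J x).symm y (w 0)) := rfl
  rw [e1, hy1]
  have e2 : (mfderiv J J' f ((extChartAt J x).symm y))
      (mfderiv 𝓘(ℝ, F) J (extChartAt J x).symm y (w 0)) =
      mfderiv 𝓘(ℝ, F) J' (f ∘ (extChartAt J x).symm) y (w 0) := by rw [h5]; rfl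
  refine (congrArg _ e2).trans ?_
  have e3 : (mfderiv 𝓘(ℝ, F) J' (f ∘ (extChartAt J x).symm) y (w 0) : F') =
      mfderiv 𝓘(ℝ, F') J' (extChartAt J' (f x)).symm (writtenInExtChartAt J J' x f y)
        (mfderiv 𝓘(ℝ, F) 𝓘(ℝ, F') (writtenInExtChartAt J J' x f) y (w 0)) := by
    have := congrArg (fun T : F →L[ℝ] F' => T (w 0)) (hD.symm.trans h4)
    exact this
  refine (congrArg (θ (f ((extChartAt J x).symm y)) : F' →L[ℝ] ℝ) e3).trans ?_
  exact oneForm_apply_congr θ ((extChartAt J' (f x)).left_inv hs3).symm _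

/-- In charts this is `extDeriv_pullback` on the model spaces. The relation between the forms is
needed only near `x`, so locally defined maps are allowed. -/
lemma extDerivOneForm_pullback [J.Boundaryless] [J'.Boundaryless] [IsManifold J ∞ N]
    [IsManifold J' ∞ N'] {f : N → N'} {x : N} (hf : ContMDiffAt J J' ∞ f x)
    {θ' : ∀ x : N, TangentSpace J x →L[ℝ] ℝ} {θ : ∀ x : N', TangentSpace J' x →L[ℝ] ℝ}
    (h : ∀ᶠ z in 𝓝 x, ∀ w, θ' z w = θ (f z) (mfderiv J J' f z w))
    (hd : DifferentiableAt ℝ (chartOneForm J' θ (f x)) (extChartAt J' (f x) (f x)))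
    (u v : TangentSpace J x) :
    extDerivOneForm J θ' x u v =
      extDerivOneForm J' θ (f x) (mfderiv J J' f x u) (mfderiv J J' f x v) := by
  have hF : ContDiffAt ℝ ∞ (writtenInExtChartAt J J' x f) (extChartAt J x x) := by
    have := (contMDiffAt_iff.1 hf).2
    rwa [J.range_eq_univ, contDiffWithinAt_univ] at this
  have hFx : writtenInExtChartAt J J' x f (extChartAt J x x) = extChartAt J' (f x) (f x) := by
    simp [writtenInExtChartAt]
  have hmf : mfderiv J J' f x =
      fderiv ℝ (writtenInExtChartAt J J' x f) (extChartAt J x x) := by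
    rw [(hf.mdifferentiableAt (by simp)).mfderiv, J.range_eq_univ, fderivWithin_univ]
  rw [extDerivOneForm_eq, extDerivOneForm_eq, (Filter.EventuallyEq.extDeriv_eq
    (chartOneForm_pullback hf h) : _), extDeriv_pullback (hFx.symm ▸ hd) hF (r := ∞)
    -- Over `ℝ` two derivatives suffice: commuting `d` with the pullback uses the symmetry of the
    -- second derivative.
    (by rw [minSmoothness_of_isRCLikeNormedField]; exact WithTop.coe_le_coe.2 le_top), hFx, hmf]
  simp only [ContinuousAlternatingMap.compContinuousLinearMap_apply]
  congr 1
  ext i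
  fin_cases i <;> rfl

end Naturality

lemma _root_.DifferentiableAt.ofSubsingleton_comp {G G₁ G' : Type*} [NormedAddCommGroup G]
    [NormedSpace ℝ G] [NormedAddCommGroup G₁] [NormedSpace ℝ G₁] [NormedAddCommGroup G']
    [NormedSpace ℝ G'] {T : G' → G₁ →L[ℝ] ℝ} {y : G'} (hT : DifferentiableAt ℝ T y)
    (c : G →L[ℝ] G₁) :
    DifferentiableAt ℝ
      (fun y => ContinuousAlternatingMap.ofSubsingleton ℝ G ℝ (0 : Fin 1) ((T y).comp c)) y :=
  (ContinuousAlternatingMap.ofSubsingletonLIE (𝕜 := ℝ) (E := G) (F := ℝ)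
    (0 : Fin 1)).differentiableAt.comp y
    (((ContinuousLinearMap.compL ℝ G G₁ ℝ).flip c).differentiableAt.comp y hT)

/-! ### Charts of the cotangent bundle and the canonical form in coordinates. -/

section Cotangent

variable {E : Type*} [NormedAddCommGroup E] [NormedSpace ℝ E]
  {Q : Type*} [TopologicalSpace Q] [ChartedSpace E Q] [IsManifold 𝓘(ℝ, E) ∞ Q]

lemma mem_extChartAt_source_cotangent {p z : CoTQ E Q} :
    z ∈ (extChartAt (coModel E) p).source ↔ z.1 ∈ (extChartAt 𝓘(ℝ, E) p.1).source := by
  rw [FiberBundle.extChartAt]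
  simp only [PartialEquiv.trans_source, mfld_simps]
  exact ⟨fun h => h.2, fun h => ⟨⟨h, mem_univ _⟩, h⟩⟩

lemma extChartAt_cotangent_fst (p z : CoTQ E Q) :
    (extChartAt (coModel E) p z).1 = extChartAt 𝓘(ℝ, E) p.1 z.1 := by
  rw [FiberBundle.extChartAt]
  rfl

/-- These are the usual induced coordinates `(x, ξ)`: the fibre coordinate is the covector pulled
back by the inverse of the base chart. -/
lemma extChartAt_cotangent_snd {p z : CoTQ E Q}
    (hz : z.1 ∈ (extChartAt 𝓘(ℝ, E) p.1).source) (w : E) :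
    (extChartAt (coModel E) p z).2 w =
      (z.2 : E →L[ℝ] ℝ) (mfderiv 𝓘(ℝ, E) 𝓘(ℝ, E) (extChartAt 𝓘(ℝ, E) p.1).symm
        (extChartAt 𝓘(ℝ, E) p.1 z.1) w) := by
  have : IsManifold 𝓘(ℝ, E) 1 Q := IsManifold.of_le (n := ∞) (by simp)
  have h := TangentBundle.symmL_trivializationAt (I := 𝓘(ℝ, E)) (M := Q)
    (x₀ := p.1) (x := z.1) (by simpa using hz)
  rw [FiberBundle.extChartAt]
  change ContinuousLinearMap.inCoordinates E (TangentSpace 𝓘(ℝ, E)) ℝ (Bundle.Trivial Q ℝ)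
    p.1 z.1 p.1 z.1 z.2 w = _
  simp only [ContinuousLinearMap.inCoordinates, h]
  simp [mfderivWithin_univ]
  rfl

/-- In a chart, the tautological form is `(x, ξ) ↦ ξ dx`. -/
lemma chartOneForm_tautologicalForm (p : CoTQ E Q) {y : E × (E →L[ℝ] ℝ)}
    (hy : y ∈ (extChartAt (coModel E) p).target) :
    chartOneForm (coModel E) tautologicalForm p y =
      ContinuousAlternatingMap.ofSubsingleton ℝ (E × (E →L[ℝ] ℝ)) ℝ (0 : Fin 1)
        (y.2.comp (ContinuousLinearMap.fst ℝ E (E →L[ℝ] ℝ))) := by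
  set e := extChartAt (coModel E) p with he
  set φ := extChartAt 𝓘(ℝ, E) p.1
  have hz : (e.symm y).1 ∈ φ.source := mem_extChartAt_source_cotangent.1 (e.map_target hy)
  have hproj : ∀ y' ∈ e.target, (e.symm y').1 = φ.symm y'.1 := by
    intro y' hy'
    have h1 : (e.symm y').1 ∈ φ.source := mem_extChartAt_source_cotangent.1 (e.map_target hy')
    have h2 := extChartAt_cotangent_fst p (e.symm y')
    rw [← he, e.right_inv hy'] at h2
    rw [h2, φ.left_inv h1]
  have h1 : φ (e.symm y).1 = y.1 := by
    have h2 := extChartAt_cotangent_fst p (e.symm y)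
    rw [← he, e.right_inv hy] at h2
    exact h2.symm
  have hy1 : y.1 ∈ φ.target := h1 ▸ φ.map_source hz
  have hds : MDifferentiableAt 𝓘(ℝ, E × (E →L[ℝ] ℝ)) (coModel E) e.symm y :=
    mdifferentiableAt_extChartAt_symm_of_boundaryless hy
  have hπ : MDifferentiableAt (coModel E) 𝓘(ℝ, E) (fun z : CoTQ E Q => z.1) (e.symm y) :=
    (contMDiff_proj (n := 1) (IB := 𝓘(ℝ, E)) (CotangentSpace E : Q → Type _)).mdifferentiableAt
      (by simp)
  have hφ : MDifferentiableAt 𝓘(ℝ, E) 𝓘(ℝ, E) φ.symm y.1 :=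
    mdifferentiableAt_extChartAt_symm_of_boundaryless hy1
  have hfst : MDifferentiableAt 𝓘(ℝ, E × (E →L[ℝ] ℝ)) 𝓘(ℝ, E)
      (Prod.fst : E × (E →L[ℝ] ℝ) → E) y :=
    (differentiableAt_fst).mdifferentiableAt
  have hE : ((fun z : CoTQ E Q => z.1) ∘ e.symm) =ᶠ[𝓝 y] (φ.symm ∘ Prod.fst) := by
    filter_upwards [(isOpen_extChartAt_target p).mem_nhds hy] with y' hy'
    exact hproj y' hy'
  have hD := hE.mfderiv_eq (I := 𝓘(ℝ, E × (E →L[ℝ] ℝ))) (I' := 𝓘(ℝ, E))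
  have h4 := mfderiv_comp y hπ hds
  have h5 := mfderiv_comp (I := 𝓘(ℝ, E × (E →L[ℝ] ℝ))) y hφ hfst
  have h6 := h4.symm.trans (hD.trans h5)
  ext w
  have e1 : chartOneForm (coModel E) tautologicalForm p y w = ((e.symm y).2 : E →L[ℝ] ℝ)
      (mfderiv (coModel E) 𝓘(ℝ, E) (fun z : CoTQ E Q => z.1) (e.symm y)
        (mfderiv 𝓘(ℝ, E × (E →L[ℝ] ℝ)) (coModel E) e.symm y (w 0))) := rfl
  have e2 : (mfderiv (coModel E) 𝓘(ℝ, E) (fun z : CoTQ E Q => z.1) (e.symm y)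
        (mfderiv 𝓘(ℝ, E × (E →L[ℝ] ℝ)) (coModel E) e.symm y (w 0)) : E) =
      mfderiv 𝓘(ℝ, E) 𝓘(ℝ, E) φ.symm y.1 (w 0).1 := by
    have := congrArg (fun T : (E × (E →L[ℝ] ℝ)) →L[ℝ] E => T (w 0)) h6
    refine this.trans ?_
    rw [mfderiv_eq_fderiv, fderiv_fst]
    rfl
  -- The derivative of the inverse base chart produced by the projection is exactly the one built
  -- into the fibre coordinate, so only `y.2` applied to the base component remains.
  have h7 := extChartAt_cotangent_snd (p := p) (z := e.symm y) hz (w 0).1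
  rw [← he, e.right_inv hy, h1] at h7
  rw [e1, e2, ← h7]
  rfl

lemma chartOneForm_tautologicalForm_eventuallyEq (p : CoTQ E Q) :
    chartOneForm (coModel E) tautologicalForm p =ᶠ[𝓝 (extChartAt (coModel E) p p)]
      fun y => ContinuousAlternatingMap.ofSubsingleton ℝ (E × (E →L[ℝ] ℝ)) ℝ (0 : Fin 1)
        (y.2.comp (ContinuousLinearMap.fst ℝ E (E →L[ℝ] ℝ))) := by
  filter_upwards [extChartAt_target_mem_nhds (I := coModel E) p] with y hy
  exact chartOneForm_tautologicalForm p hy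

lemma differentiableAt_chartOneForm_tautologicalForm (p : CoTQ E Q) :
    DifferentiableAt ℝ (chartOneForm (coModel E) tautologicalForm p)
      (extChartAt (coModel E) p p) := by
  refine DifferentiableAt.congr_of_eventuallyEq ?_ (chartOneForm_tautologicalForm_eventuallyEq p)
  exact differentiableAt_snd.ofSubsingleton_comp (ContinuousLinearMap.fst ℝ E (E →L[ℝ] ℝ))

/-- Darboux form: differentiate `ξ dx` in the chart at `p`. The right-hand side does not involve
`p`, which later allows values at propositionally equal points to be compared without transport. -/
lemma canonicalForm_apply (p : CoTQ E Q) (u v : E × (E →L[ℝ] ℝ)) :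
    canonicalForm p u v = v.2 u.1 - u.2 v.1 := by
  have hE := chartOneForm_tautologicalForm_eventuallyEq p
  have hd := differentiableAt_chartOneForm_tautologicalForm p
  have hfd : ∀ a b : E × (E →L[ℝ] ℝ),
      fderiv ℝ (fun y : E × (E →L[ℝ] ℝ) => y.2 a.1) (extChartAt (coModel E) p p) b = b.2 a.1 := by
    intro a b
    have : HasFDerivAt (fun y : E × (E →L[ℝ] ℝ) => y.2 a.1)
      ((ContinuousLinearMap.apply ℝ ℝ a.1).comp (ContinuousLinearMap.snd ℝ E (E →L[ℝ] ℝ)))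
      (extChartAt (coModel E) p p) :=
      ((ContinuousLinearMap.apply ℝ ℝ a.1).comp
        (ContinuousLinearMap.snd ℝ E (E →L[ℝ] ℝ))).hasFDerivAt
    rw [this.fderiv]
    rfl
  have h : extDerivOneForm (coModel E) tautologicalForm p u v = u.2 v.1 - v.2 u.1 := by
    refine (extDerivOneForm_eq (J := coModel E) (tautologicalForm (E := E) (Q := Q)) p u v).trans ?_
    rw [hE.extDeriv_eq, extDeriv_apply (hE.differentiableAt_iff.1 hd), Fin.sum_univ_two]
    have h0 := hfd v u
    have h1 := hfd u v
    simp only [Fin.val_zero, pow_zero, one_smul, Fin.val_one, pow_one, neg_smul]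
    rw [← h0, ← h1, sub_eq_add_neg]
    rfl
  unfold canonicalForm
  rw [h]
  ring

lemma hasMFDerivAt_cotangent_proj (p : CoTQ E Q) :
    HasMFDerivAt (coModel E) 𝓘(ℝ, E) (fun z : CoTQ E Q => z.1) p
      (ContinuousLinearMap.fst ℝ E (E →L[ℝ] ℝ)) := by
  refine ⟨(contMDiff_proj (n := 1) (IB := 𝓘(ℝ, E))
    (CotangentSpace E : Q → Type _)).continuous.continuousAt, ?_⟩
  refine HasFDerivAt.hasFDerivWithinAt ?_
  refine (hasFDerivAt_fst).congr_of_eventuallyEq ?_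
  filter_upwards [extChartAt_target_mem_nhds (I := coModel E) p] with y hy
  have h := extChartAt_cotangent_fst p ((extChartAt (coModel E) p).symm y)
  rw [(extChartAt (coModel E) p).right_inv hy] at h
  exact h.symm

/-- The base chart has identity derivative at its own centre, so the fibre over the centre is read
unchanged. -/
lemma extChartAt_cotangent_fiber (q : Q) (ξ η : E →L[ℝ] ℝ) :
    extChartAt (coModel E) (coPt q ξ : CoTQ E Q) (coPt q η) = (extChartAt 𝓘(ℝ, E) q q, η) := by
  have : IsManifold 𝓘(ℝ, E) 1 Q := IsManifold.of_le (n := ∞) (by simp)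
  refine Prod.ext (extChartAt_cotangent_fst _ _) ?_
  ext w
  refine (extChartAt_cotangent_snd (p := (coPt q ξ : CoTQ E Q)) (z := coPt q η)
    (mem_extChartAt_source (I := 𝓘(ℝ, E)) q) w).trans ?_
  have h := mfderivWithin_range_extChartAt_symm (I := 𝓘(ℝ, E)) (x := q)
  rw [ModelWithCorners.range_eq_univ, mfderivWithin_univ] at h
  have h' : (mfderiv 𝓘(ℝ, E) 𝓘(ℝ, E) (extChartAt 𝓘(ℝ, E) q).symm (extChartAt 𝓘(ℝ, E) q q) w : E)
      = w := by rw [h]; rfl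
  change η (mfderiv 𝓘(ℝ, E) 𝓘(ℝ, E) (extChartAt 𝓘(ℝ, E) q).symm (extChartAt 𝓘(ℝ, E) q q) w) = η w
  rw [h']

lemma hasMFDerivAt_coPt (q : Q) (ξ : E →L[ℝ] ℝ) :
    HasMFDerivAt 𝓘(ℝ, E →L[ℝ] ℝ) (coModel E) (fun η : E →L[ℝ] ℝ => (coPt q η : CoTQ E Q)) ξ
      (ContinuousLinearMap.inr ℝ E (E →L[ℝ] ℝ)) := by
  refine ⟨(FiberBundle.continuous_totalSpaceMk (E →L[ℝ] ℝ)
    (CotangentSpace E : Q → Type _) q).continuousAt, ?_⟩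
  refine HasFDerivAt.hasFDerivWithinAt ?_
  have : writtenInExtChartAt 𝓘(ℝ, E →L[ℝ] ℝ) (coModel E) ξ
      (fun η : E →L[ℝ] ℝ => (coPt q η : CoTQ E Q)) = fun η => (extChartAt 𝓘(ℝ, E) q q, η) := by
    ext1 η
    exact extChartAt_cotangent_fiber q ξ η
  rw [this]
  exact hasFDerivAt_prodMk_right _ _

end Cotangent

/-! ### Fibres of the tangent bundle in charts, and the vertical lift. -/

section Tangent

variable {E : Type*} [NormedAddCommGroup E] [NormedSpace ℝ E]
  {Q : Type*} [TopologicalSpace Q] [ChartedSpace E Q] [IsManifold 𝓘(ℝ, E) ∞ Q]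

lemma extChartAt_tangent_fiber (q : Q) (v w : E) :
    extChartAt 𝓘(ℝ, E).tangent (tPt q v : TQ E Q) (tPt q w) = (extChartAt 𝓘(ℝ, E) q q, w) := by
  have : IsManifold 𝓘(ℝ, E) 1 Q := IsManifold.of_le (n := ∞) (by simp)
  refine (congrFun (congrArg PartialEquiv.toFun
    (FiberBundle.extChartAt (IB := 𝓘(ℝ, E)) (tPt q v : TQ E Q))) (tPt q w)).trans ?_
  refine Prod.ext rfl ?_
  exact (tangentBundleCore 𝓘(ℝ, E) Q).coordChange_self (achart E q) q (mem_chart_source E q) w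

lemma contMDiff_tPt (q : Q) :
    ContMDiff 𝓘(ℝ, E) 𝓘(ℝ, E).tangent ∞ (fun w : E => (tPt q w : TQ E Q)) := by
  intro v
  refine contMDiffAt_iff.2 ⟨(FiberBundle.continuous_totalSpaceMk E
    (TangentSpace 𝓘(ℝ, E) : Q → Type _) q).continuousAt, ?_⟩
  have : (extChartAt 𝓘(ℝ, E).tangent (tPt q v : TQ E Q)) ∘ (fun w : E => (tPt q w : TQ E Q)) ∘
      (extChartAt 𝓘(ℝ, E) v).symm = fun w => (extChartAt 𝓘(ℝ, E) q q, w) := by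
    ext1 w
    exact extChartAt_tangent_fiber q v w
  rw [this]
  fun_prop

lemma hasMFDerivAt_tPt (q : Q) (v : E) :
    HasMFDerivAt 𝓘(ℝ, E) 𝓘(ℝ, E).tangent (fun w : E => (tPt q w : TQ E Q)) v
      (ContinuousLinearMap.inr ℝ E E) := by
  refine ⟨(FiberBundle.continuous_totalSpaceMk E
    (TangentSpace 𝓘(ℝ, E) : Q → Type _) q).continuousAt, ?_⟩
  refine HasFDerivAt.hasFDerivWithinAt ?_
  have : writtenInExtChartAt 𝓘(ℝ, E) 𝓘(ℝ, E).tangent v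
      (fun w : E => (tPt q w : TQ E Q)) = fun w => (extChartAt 𝓘(ℝ, E) q q, w) := by
    ext1 w
    exact extChartAt_tangent_fiber q v w
  rw [this]
  exact hasFDerivAt_prodMk_right _ _

lemma verticalLift_apply (v : TQ E Q) (u : E) : verticalLift v u = ((0, u) : E × E) := by
  have h := (hasMFDerivAt_tPt (E := E) v.1 v.2).mfderiv
  exact congrArg (fun T : E →L[ℝ] E × E => T u) h

end Tangent

/-! ### Nondegeneracy of the canonical form and the Hamiltonian field. -/

section Symplectic

variable {E : Type*} [NormedAddCommGroup E] [NormedSpace ℝ E]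
  {Q : Type*} [TopologicalSpace Q] [ChartedSpace E Q] [IsManifold 𝓘(ℝ, E) ∞ Q]

/-- Reflexivity of a finite-dimensional space, phrased for continuous duals. -/
lemma exists_eval_eq [FiniteDimensional ℝ E] (b : (E →L[ℝ] ℝ) →L[ℝ] ℝ) :
    ∃ x : E, ∀ ξ : E →L[ℝ] ℝ, ξ x = b ξ := by
  let b' : Module.Dual ℝ (Module.Dual ℝ E) :=
    (b : (E →L[ℝ] ℝ) →ₗ[ℝ] ℝ).comp
      (LinearMap.toContinuousLinearMap : (E →ₗ[ℝ] ℝ) ≃ₗ[ℝ] (E →L[ℝ] ℝ)).toLinearMap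
  refine ⟨(Module.evalEquiv ℝ E).symm b', fun ξ => ?_⟩
  have h := Module.apply_evalEquiv_symm_apply (R := ℝ) (M := E) (ξ : E →ₗ[ℝ] ℝ) b'
  refine Eq.trans h ?_
  refine congrArg b ?_
  ext x
  rfl

lemma exists_canonicalForm_eq [FiniteDimensional ℝ E] (p : CoTQ E Q)
    (a : E × (E →L[ℝ] ℝ) →L[ℝ] ℝ) :
    ∃ z : E × (E →L[ℝ] ℝ), ∀ w : E × (E →L[ℝ] ℝ), canonicalForm p z w = a w := by
  obtain ⟨x, hx⟩ := exists_eval_eq (a.comp (ContinuousLinearMap.inr ℝ E (E →L[ℝ] ℝ)))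
  -- Solves `w.2 z.1 - z.2 w.1 = a w`: the part of `a` on covectors is evaluation at `x`, and the
  -- part on base vectors is `-z.2`.
  refine ⟨(x, -(a.comp (ContinuousLinearMap.inl ℝ E (E →L[ℝ] ℝ)))), fun w => ?_⟩
  rw [canonicalForm_apply, hx]
  obtain ⟨w₁, w₂⟩ := w
  have : ((w₁, w₂) : E × (E →L[ℝ] ℝ)) = (w₁, 0) + (0, w₂) := by simp
  rw [this, map_add]
  simp [add_comm]

lemma eq_of_canonicalForm_eq (p : CoTQ E Q) {z z' : E × (E →L[ℝ] ℝ)}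
    (h : ∀ w : E × (E →L[ℝ] ℝ), canonicalForm p z w = canonicalForm p z' w) : z = z' := by
  simp only [canonicalForm_apply] at h
  refine Prod.ext ?_ ?_
  · refine (SeparatingDual.eq_iff_forall_dual_eq (R := ℝ)).2 fun ξ => ?_
    simpa using h (0, ξ)
  · ext w
    simpa using h (w, 0)

/-- Existence of a solution is what makes the `epsilon` choice in `dynamicalField` meaningful. It is
pure linear algebra at `p`, hence no smoothness of `H` enters. -/
lemma canonicalForm_hamiltonianField [FiniteDimensional ℝ E] (H : CoTQ E Q → ℝ) (p : CoTQ E Q)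
    (w : TangentSpace (coModel E) p) :
    canonicalForm p (hamiltonianField H p) w = (mfderiv (coModel E) 𝓘(ℝ, ℝ) H p w : ℝ) := by
  have h : ∃ z : TangentSpace (coModel E) p, ∀ w : TangentSpace (coModel E) p,
      canonicalForm p z w = (mfderiv (coModel E) 𝓘(ℝ, ℝ) H p w : ℝ) :=
    exists_canonicalForm_eq p (mfderiv (coModel E) 𝓘(ℝ, ℝ) H p)
  exact Classical.epsilon_spec h w

/-- A `1`-form is the pullback by itself of the tautological form. -/
lemma extDerivOneForm_eq_canonicalForm {α : ∀ q : Q, CotangentSpace E q} {q : Q}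
    (hα : ContMDiffAt 𝓘(ℝ, E) (coModel E) ∞ (fun q => coPt q (α q)) q)
    (u v : TangentSpace 𝓘(ℝ, E) q) :
    extDerivOneForm 𝓘(ℝ, E) α q u v = -canonicalForm (coPt q (α q))
      (mfderiv 𝓘(ℝ, E) (coModel E) (fun q => coPt q (α q)) q u)
      (mfderiv 𝓘(ℝ, E) (coModel E) (fun q => coPt q (α q)) q v) := by
  have h1 : ∀ᶠ z in 𝓝 q, MDifferentiableAt 𝓘(ℝ, E) (coModel E) (fun q => coPt q (α q)) z := by
    have := hα.of_le (m := 1) (by simp)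
    filter_upwards [(contMDiffAt_iff_contMDiffAt_nhds (by simp)).1 this] with z hz using
      hz.mdifferentiableAt (by simp)
  rw [canonicalForm, neg_neg]
  refine extDerivOneForm_pullback (J := 𝓘(ℝ, E)) (J' := coModel E)
    (f := fun q => (coPt q (α q) : CoTQ E Q)) hα (θ' := α) (θ := tautologicalForm) ?_
    (differentiableAt_chartOneForm_tautologicalForm _) u v
  filter_upwards [h1] with z hz w
  -- Since `α` is a section, the projection undoes its derivative, and the tautological form at `α
  -- z` returns `α z`.
  have h2 := HasMFDerivAt.comp z (hasMFDerivAt_cotangent_proj (coPt z (α z))) hz.hasMFDerivAt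
  have h3 := hasMFDerivAt_unique h2 (hasMFDerivAt_id (I := 𝓘(ℝ, E)) z)
  have h4 : (mfderiv (coModel E) 𝓘(ℝ, E) (fun z : CoTQ E Q => z.1) (coPt z (α z))
      (mfderiv 𝓘(ℝ, E) (coModel E) (fun q => coPt q (α q)) z w) : E) = w := by
    rw [(hasMFDerivAt_cotangent_proj (coPt z (α z))).mfderiv]
    exact congrArg (fun T : E →L[ℝ] E => T w) h3
  exact (congrArg (α z : E →L[ℝ] ℝ) h4).symm

end Symplectic

/-! ### The Legendre map, the energy, and their fibre derivatives. -/

section Legendre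

variable {E : Type*} [NormedAddCommGroup E] [NormedSpace ℝ E]
  {Q : Type*} [TopologicalSpace Q] [ChartedSpace E Q] [IsManifold 𝓘(ℝ, E) ∞ Q]
  {L : TQ E Q → ℝ}

lemma contDiff_fiber (hL : ContMDiff 𝓘(ℝ, E).tangent 𝓘(ℝ, ℝ) ∞ L) (q : Q) :
    ContDiff ℝ ∞ (fun w : E => L (tPt q w)) :=
  contMDiff_iff_contDiff.1 (hL.comp (contMDiff_tPt q))

lemma diffL_verticalLift (hL : ContMDiff 𝓘(ℝ, E).tangent 𝓘(ℝ, ℝ) ∞ L) (v : TQ E Q)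
    (u : TangentSpace 𝓘(ℝ, E) v.1) :
    diffL L v (verticalLift v u) = fiberDeriv L v.1 v.2 u := by
  have h := HasMFDerivAt.comp (M := E) v.2
    (hL.mdifferentiableAt (by simp) (x := v)).hasMFDerivAt (hasMFDerivAt_tPt (E := E) v.1 v.2)
  have h0 : HasFDerivAt (fun w : E => L (tPt v.1 w))
      ((diffL L v : E × E →L[ℝ] ℝ).comp (ContinuousLinearMap.inr ℝ E E)) (v.2 : E) := h.hasFDerivAt
  have h1 := h0.fderiv
  have h2 := congrArg (fun T : E →L[ℝ] ℝ => T u) h1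
  refine Eq.trans ?_ h2.symm
  exact congrArg (diffL L v : E × E →L[ℝ] ℝ) (verticalLift_apply v u)

lemma energy_eq (hL : ContMDiff 𝓘(ℝ, E).tangent 𝓘(ℝ, ℝ) ∞ L) (v : TQ E Q) :
    energy L v = fiberDeriv L v.1 v.2 v.2 - L v := by
  rw [energy, liouvilleField, diffL_verticalLift hL]

/-- `FL` covers the identity, so `Tπ ∘ T FL = Tτ`; and `dL` on vertical lifts is the fibre
derivative, that is, the covector `FL v`. -/
lemma lagrangianOneForm_eq (hL : ContMDiff 𝓘(ℝ, E).tangent 𝓘(ℝ, ℝ) ∞ L) {v : TQ E Q}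
    (hF : MDifferentiableAt 𝓘(ℝ, E).tangent (coModel E) (legendre L) v)
    (w : TangentSpace 𝓘(ℝ, E).tangent v) :
    lagrangianOneForm L v w = tautologicalForm (legendre L v)
      (mfderiv 𝓘(ℝ, E).tangent (coModel E) (legendre L) v w) := by
  have h1 := mfderiv_comp v
    (hasMFDerivAt_cotangent_proj (legendre L v)).mdifferentiableAt hF
  have h2 := congrArg (fun T : E × E →L[ℝ] E => T w) h1
  refine (diffL_verticalLift hL v _).trans ?_
  exact congrArg (fiberDeriv L v.1 v.2 : E →L[ℝ] ℝ) h2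

/-- The Lagrangian `2`-form is the pullback of the canonical form by the Legendre map. -/
lemma lagrangianForm_eq (hL : ContMDiff 𝓘(ℝ, E).tangent 𝓘(ℝ, ℝ) ∞ L) {v : TQ E Q}
    (hF : ContMDiffAt 𝓘(ℝ, E).tangent (coModel E) ∞ (legendre L) v)
    (x y : TangentSpace 𝓘(ℝ, E).tangent v) :
    lagrangianForm L v x y = canonicalForm (legendre L v)
      (mfderiv 𝓘(ℝ, E).tangent (coModel E) (legendre L) v x)
      (mfderiv 𝓘(ℝ, E).tangent (coModel E) (legendre L) v y) := by
  unfold lagrangianForm canonicalForm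
  refine congrArg Neg.neg ?_
  refine extDerivOneForm_pullback (J := 𝓘(ℝ, E).tangent) (J' := coModel E) (f := legendre L) hF ?_
    (differentiableAt_chartOneForm_tautologicalForm _) x y
  have := hF.of_le (m := 1) (by simp)
  filter_upwards [(contMDiffAt_iff_contMDiffAt_nhds (by simp)).1 this] with z hz w
  exact lagrangianOneForm_eq hL (hz.mdifferentiableAt (by simp)) w

/-- The energy is the pairing of `FL v` with `v`, minus `L`, so it inherits smoothness from `FL` and
`L`. -/
lemma contMDiffAt_energy (hL : ContMDiff 𝓘(ℝ, E).tangent 𝓘(ℝ, ℝ) ∞ L) {v : TQ E Q}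
    (hF : ContMDiffAt 𝓘(ℝ, E).tangent (coModel E) ∞ (legendre L) v) :
    ContMDiffAt 𝓘(ℝ, E).tangent 𝓘(ℝ, ℝ) ∞ (energy L) v := by
  have h := ContMDiffAt.clm_bundle_apply (n := ∞) (F₁ := E) (F₂ := ℝ)
    (E₁ := (TangentSpace 𝓘(ℝ, E) : Q → Type _)) (E₂ := Bundle.Trivial Q ℝ)
    (b := fun v : TQ E Q => v.1) (ϕ := fun v => fiberDeriv L v.1 v.2) (v := fun v => v.2)
    (IB := 𝓘(ℝ, E)) (IM := 𝓘(ℝ, E).tangent) hF contMDiffAt_id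
  have h2 := (contMDiffAt_totalSpace.1 h).2
  have h3 : energy L = fun v => fiberDeriv L v.1 v.2 v.2 - L v := funext (energy_eq hL)
  rw [h3]
  exact ContMDiffAt.sub h2 hL.contMDiffAt

lemma hasFDerivAt_fiberDeriv (hL : ContMDiff 𝓘(ℝ, E).tangent 𝓘(ℝ, ℝ) ∞ L) (q : Q) (v : E) :
    HasFDerivAt (fun w : E => (fiberDeriv L q w : E →L[ℝ] ℝ))
      (fderiv ℝ (fderiv ℝ (fun w : E => L (tPt q w))) v) v := by
  have h := (contDiff_fiber hL q).fderiv_right (m := 1) (by exact WithTop.coe_le_coe.2 le_top)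
  exact (h.differentiable (by simp) v).hasFDerivAt

/-- On vertical vectors the derivative of `FL` is the fibre Hessian of `L`. -/
lemma mfderiv_legendre_verticalLift (hL : ContMDiff 𝓘(ℝ, E).tangent 𝓘(ℝ, ℝ) ∞ L) {v : TQ E Q}
    (hF : MDifferentiableAt 𝓘(ℝ, E).tangent (coModel E) (legendre L) v) (u : E) :
    (mfderiv 𝓘(ℝ, E).tangent (coModel E) (legendre L) v ((0, u) : E × E) : E × (E →L[ℝ] ℝ)) =
      (0, fderiv ℝ (fderiv ℝ (fun w : E => L (tPt v.1 w))) v.2 u) := by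
  have h1 := HasMFDerivAt.comp (M := E) v.2 (hF.hasMFDerivAt) (hasMFDerivAt_tPt (E := E) v.1 v.2)
  have h2 := HasMFDerivAt.comp (M := E) v.2
    (hasMFDerivAt_coPt (E := E) v.1 (fiberDeriv L v.1 v.2))
    (hasFDerivAt_fiberDeriv hL v.1 v.2).hasMFDerivAt
  have h3 := hasMFDerivAt_unique h1 h2
  exact congrArg (fun T : E →L[ℝ] E × (E →L[ℝ] ℝ) => T u) h3

/-- In the product rule for `Dg(w) w - g(w)` the two first-order terms cancel and only the Hessian
term survives. -/
lemma hasFDerivAt_energy_fiber (hL : ContMDiff 𝓘(ℝ, E).tangent 𝓘(ℝ, ℝ) ∞ L) (q : Q) (v : E) :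
    HasFDerivAt (fun w : E => energy L (tPt q w))
      ((fderiv ℝ (fderiv ℝ (fun w : E => L (tPt q w))) v).flip v) v := by
  set g : E → ℝ := fun w => L (tPt q w) with hg
  have e : (fun w : E => energy L (tPt q w)) = fun w : E => fderiv ℝ g w w - g w := by
    ext1 w; exact energy_eq hL _
  have h : HasFDerivAt (fderiv ℝ g) (fderiv ℝ (fderiv ℝ g) v) v := hasFDerivAt_fiberDeriv hL q v
  rw [e]
  refine ((h.clm_apply (hasFDerivAt_id v)).sub
    ((contDiff_fiber hL q).differentiable (by simp) v).hasFDerivAt).congr_fderiv ?_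
  ext u
  simp [← hg]

lemma mfderiv_energy_verticalLift (hL : ContMDiff 𝓘(ℝ, E).tangent 𝓘(ℝ, ℝ) ∞ L) {v : TQ E Q}
    (hF : ContMDiffAt 𝓘(ℝ, E).tangent (coModel E) ∞ (legendre L) v) (u : E) :
    (mfderiv 𝓘(ℝ, E).tangent 𝓘(ℝ, ℝ) (energy L) v ((0, u) : E × E) : ℝ) =
      fderiv ℝ (fderiv ℝ (fun w : E => L (tPt v.1 w))) v.2 u v.2 := by
  have h1 := HasMFDerivAt.comp (M := E) v.2
    ((contMDiffAt_energy hL hF).mdifferentiableAt (by simp)).hasMFDerivAt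
    (hasMFDerivAt_tPt (E := E) v.1 v.2)
  exact congrArg (fun T : E →L[ℝ] ℝ => T u)
    (HasFDerivAt.unique h1.hasFDerivAt (hasFDerivAt_energy_fiber hL v.1 v.2))

end Legendre

lemma tPt_eq_of_eq {E : Type*} [NormedAddCommGroup E] [NormedSpace ℝ E]
    {Q : Type*} [TopologicalSpace Q] [ChartedSpace E Q] {q : Q} {w : E} :
    ∀ {v : TQ E Q}, v.1 = q → (v.2 : E) = w → tPt q w = v := by
  rintro ⟨_, _⟩ rfl rfl
  rfl

lemma comp_one_smulRight {G G' : Type*} [NormedAddCommGroup G] [NormedSpace ℝ G]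
    [NormedAddCommGroup G'] [NormedSpace ℝ G'] (T : G →L[ℝ] G') (z : G) :
    T.comp ((1 : ℝ →L[ℝ] ℝ).smulRight z) = (1 : ℝ →L[ℝ] ℝ).smulRight (T z) := by
  ext
  simp

/-! ### Inverting the Legendre map and relating the two dynamics. -/

section HamiltonJacobiCorrespondence

variable {E : Type*} [NormedAddCommGroup E] [NormedSpace ℝ E]
  {Q : Type*} [TopologicalSpace Q] [ChartedSpace E Q] [IsManifold 𝓘(ℝ, E) ∞ Q]
  {L : TQ E Q → ℝ}
  {Φ : PartialDiffeomorph 𝓘(ℝ, E).tangent (coModel E) (TQ E Q) (CoTQ E Q) ∞}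

lemma contMDiffAt_legendre (hΦ : ∀ v ∈ Φ.source, Φ v = legendre L v) {v : TQ E Q}
    (hv : v ∈ Φ.source) : ContMDiffAt 𝓘(ℝ, E).tangent (coModel E) ∞ (legendre L) v := by
  refine (Φ.contMDiffOn.contMDiffAt (Φ.open_source.mem_nhds hv)).congr_of_eventuallyEq ?_
  filter_upwards [Φ.open_source.mem_nhds hv] with z hz using (hΦ z hz).symm

lemma symm_legendre (hΦ : ∀ v ∈ Φ.source, Φ v = legendre L v) {v : TQ E Q}
    (hv : v ∈ Φ.source) : Φ.symm (legendre L v) = v := by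
  rw [← hΦ v hv]
  exact Φ.toPartialEquiv.left_inv hv

lemma legendre_mem_target (hΦ : ∀ v ∈ Φ.source, Φ v = legendre L v) {v : TQ E Q}
    (hv : v ∈ Φ.source) : legendre L v ∈ Φ.target :=
  hΦ v hv ▸ Φ.toPartialEquiv.map_source hv

lemma symm_mem_source {p : CoTQ E Q} (hp : p ∈ Φ.target) : Φ.symm p ∈ Φ.source :=
  Φ.toPartialEquiv.map_target hp

lemma legendre_symm (hΦ : ∀ v ∈ Φ.source, Φ v = legendre L v) {p : CoTQ E Q}
    (hp : p ∈ Φ.target) : legendre L (Φ.symm p) = p := by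
  rw [← hΦ _ (symm_mem_source hp)]
  exact Φ.toPartialEquiv.right_inv hp

lemma contMDiffAt_symm {p : CoTQ E Q} (hp : p ∈ Φ.target) :
    ContMDiffAt (coModel E) 𝓘(ℝ, E).tangent ∞ Φ.symm p :=
  Φ.symm.contMDiffOn.contMDiffAt (Φ.open_target.mem_nhds hp)

lemma mfderiv_symm_mfderiv_legendre (hΦ : ∀ v ∈ Φ.source, Φ v = legendre L v) {v : TQ E Q}
    (hv : v ∈ Φ.source) (w : E × E) :
    (mfderiv (coModel E) 𝓘(ℝ, E).tangent Φ.symm (legendre L v)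
      (mfderiv 𝓘(ℝ, E).tangent (coModel E) (legendre L) v w) : E × E) = w := by
  have hF := ((contMDiffAt_legendre hΦ hv).mdifferentiableAt (by simp)).hasMFDerivAt
  have hS := ((contMDiffAt_symm (legendre_mem_target hΦ hv)).mdifferentiableAt
    (by simp)).hasMFDerivAt
  have h1 := (HasMFDerivAt.comp v hS hF)
  have h2 := (hasMFDerivAt_id (I := 𝓘(ℝ, E).tangent) v).congr_of_eventuallyEq
    (f₁ := Φ.symm ∘ legendre L) (by
      filter_upwards [Φ.open_source.mem_nhds hv] with z hz using symm_legendre hΦ hz)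
  exact congrArg (fun T : E × E →L[ℝ] E × E => T w) (hasMFDerivAt_unique h1 h2)

lemma mfderiv_legendre_mfderiv_symm (hΦ : ∀ v ∈ Φ.source, Φ v = legendre L v) {v : TQ E Q}
    (hv : v ∈ Φ.source) (w : E × (E →L[ℝ] ℝ)) :
    (mfderiv 𝓘(ℝ, E).tangent (coModel E) (legendre L) v
      (mfderiv (coModel E) 𝓘(ℝ, E).tangent Φ.symm (legendre L v) w) : E × (E →L[ℝ] ℝ)) = w := by
  have hF : HasMFDerivAt 𝓘(ℝ, E).tangent (coModel E) (legendre L) (Φ.symm (legendre L v))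
      (mfderiv 𝓘(ℝ, E).tangent (coModel E) (legendre L) v) := by
    rw [symm_legendre hΦ hv]
    exact ((contMDiffAt_legendre hΦ hv).mdifferentiableAt (by simp)).hasMFDerivAt
  have hS := ((contMDiffAt_symm (legendre_mem_target hΦ hv)).mdifferentiableAt
    (by simp)).hasMFDerivAt
  have h1 := (HasMFDerivAt.comp (legendre L v) hF hS)
  have h2 := (hasMFDerivAt_id (I := coModel E) (legendre L v)).congr_of_eventuallyEq
    (f₁ := legendre L ∘ Φ.symm) (by
      filter_upwards [Φ.open_target.mem_nhds (legendre_mem_target hΦ hv)] with z hz using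
        legendre_symm hΦ hz)
  exact congrArg (fun T : E × (E →L[ℝ] ℝ) →L[ℝ] E × (E →L[ℝ] ℝ) => T w) (hasMFDerivAt_unique h1 h2)

lemma mfderiv_hamiltonian_mfderiv_legendre (hL : ContMDiff 𝓘(ℝ, E).tangent 𝓘(ℝ, ℝ) ∞ L)
    (hΦ : ∀ v ∈ Φ.source, Φ v = legendre L v) {v : TQ E Q} (hv : v ∈ Φ.source) (w : E × E) :
    (mfderiv (coModel E) 𝓘(ℝ, ℝ) (energy L ∘ Φ.symm) (legendre L v)
      (mfderiv 𝓘(ℝ, E).tangent (coModel E) (legendre L) v w) : ℝ) =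
      mfderiv 𝓘(ℝ, E).tangent 𝓘(ℝ, ℝ) (energy L) v w := by
  have hF := contMDiffAt_legendre hΦ hv
  have hE : HasMFDerivAt 𝓘(ℝ, E).tangent 𝓘(ℝ, ℝ) (energy L) (Φ.symm (legendre L v))
      (mfderiv 𝓘(ℝ, E).tangent 𝓘(ℝ, ℝ) (energy L) v) := by
    rw [symm_legendre hΦ hv]
    exact ((contMDiffAt_energy hL hF).mdifferentiableAt (by simp)).hasMFDerivAt
  have hS := ((contMDiffAt_symm (legendre_mem_target hΦ hv)).mdifferentiableAt
    (by simp)).hasMFDerivAt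
  rw [(HasMFDerivAt.comp (legendre L v) hE hS).mfderiv]
  exact congrArg (mfderiv 𝓘(ℝ, E).tangent 𝓘(ℝ, ℝ) (energy L) v : E × E →L[ℝ] ℝ)
    (mfderiv_symm_mfderiv_legendre hΦ hv w)

/-- The Legendre map sends `Γ_L` to `Z_H`. -/
lemma mfderiv_legendre_lagrangianField [FiniteDimensional ℝ E]
    (hL : ContMDiff 𝓘(ℝ, E).tangent 𝓘(ℝ, ℝ) ∞ L)
    (hΦ : ∀ v ∈ Φ.source, Φ v = legendre L v) {v : TQ E Q} (hv : v ∈ Φ.source) :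
    mfderiv 𝓘(ℝ, E).tangent (coModel E) (legendre L) v (lagrangianField L v) =
      hamiltonianField (energy L ∘ Φ.symm) (legendre L v) := by
  have hF := contMDiffAt_legendre hΦ hv
  set A : E × E →L[ℝ] E × (E →L[ℝ] ℝ) :=
    mfderiv 𝓘(ℝ, E).tangent (coModel E) (legendre L) v with hA
  set Z : E × (E →L[ℝ] ℝ) := hamiltonianField (energy L ∘ Φ.symm) (legendre L v) with hZ
  have hZw : ∀ w : E × E, canonicalForm (legendre L v) Z (A w) =
      (mfderiv 𝓘(ℝ, E).tangent 𝓘(ℝ, ℝ) (energy L) v w : ℝ) := fun w =>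
    (canonicalForm_hamiltonianField (energy L ∘ Φ.symm) (legendre L v) (A w)).trans
      (mfderiv_hamiltonian_mfderiv_legendre hL hΦ hv w)
  have hΓ : ∀ w : TangentSpace 𝓘(ℝ, E).tangent v, lagrangianForm L v (lagrangianField L v) w =
      (mfderiv 𝓘(ℝ, E).tangent 𝓘(ℝ, ℝ) (energy L) v w : ℝ) := by
    have h : ∃ z : TangentSpace 𝓘(ℝ, E).tangent v, ∀ w : TangentSpace 𝓘(ℝ, E).tangent v,
        lagrangianForm L v z w = (mfderiv 𝓘(ℝ, E).tangent 𝓘(ℝ, ℝ) (energy L) v w : ℝ) := by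
      -- The image of `Z_H` under the inverse Legendre map solves the Lagrangian equation, so the
      -- `epsilon` choice defining `Γ_L` does too.
      refine ⟨mfderiv (coModel E) 𝓘(ℝ, E).tangent Φ.symm (legendre L v) Z, fun w => ?_⟩
      refine (lagrangianForm_eq hL hF _ _).trans (Eq.trans ?_ (hZw w))
      exact congrArg (fun z : E × (E →L[ℝ] ℝ) => canonicalForm (legendre L v) z (A w))
        (mfderiv_legendre_mfderiv_symm hΦ hv Z)
    exact Classical.epsilon_spec h
  refine eq_of_canonicalForm_eq (legendre L v) fun w => ?_
  -- The derivative of `FL` is onto, so testing against its values determines the vector.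
  have hw := mfderiv_legendre_mfderiv_symm hΦ hv w
  rw [← hw]
  exact ((lagrangianForm_eq hL hF _ _).symm.trans (hΓ _)).trans (hZw _).symm

/-- The second-order condition: the base component of `Z_H` at `FL v` is `v`. -/
lemma hamiltonianField_legendre_fst [FiniteDimensional ℝ E]
    (hL : ContMDiff 𝓘(ℝ, E).tangent 𝓘(ℝ, ℝ) ∞ L)
    (hΦ : ∀ v ∈ Φ.source, Φ v = legendre L v) {v : TQ E Q} (hv : v ∈ Φ.source) :
    (hamiltonianField (energy L ∘ Φ.symm) (legendre L v) : E × (E →L[ℝ] ℝ)).1 = v.2 := by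
  have hF := contMDiffAt_legendre hΦ hv
  set Z : E × (E →L[ℝ] ℝ) := hamiltonianField (energy L ∘ Φ.symm) (legendre L v) with hZ
  set g : E → ℝ := fun w => L (tPt v.1 w) with hg
  let v₂ : E := v.2
  have hD : ∀ u : E, (mfderiv 𝓘(ℝ, E).tangent (coModel E) (legendre L) v ((0, u) : E × E) :
      E × (E →L[ℝ] ℝ)) = (0, fderiv ℝ (fderiv ℝ g) v₂ u) := fun u =>
    mfderiv_legendre_verticalLift hL (hF.mdifferentiableAt (by simp)) u
  -- Test `i(Z) ω = dH` on the images of vertical vectors: their base component vanishes, so only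
  -- `Z.1` is seen, paired through the Hessian.
  have h1 : ∀ u : E, fderiv ℝ (fderiv ℝ g) v₂ u Z.1 = fderiv ℝ (fderiv ℝ g) v₂ u v₂ := by
    intro u
    have h2 := canonicalForm_hamiltonianField (energy L ∘ Φ.symm) (legendre L v)
      (mfderiv 𝓘(ℝ, E).tangent (coModel E) (legendre L) v ((0, u) : E × E))
    have h3 := (mfderiv_hamiltonian_mfderiv_legendre hL hΦ hv (0, u)).trans
      (mfderiv_energy_verticalLift hL hF u)
    have h4 := (canonicalForm_apply (legendre L v) Z _).symm.trans (h2.trans h3)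
    rw [hD u] at h4
    simpa using h4
  have hsymm : IsSymmSndFDerivAt ℝ g v₂ :=
    ((contDiff_fiber hL v.1).contDiffAt (x := v₂)).isSymmSndFDerivAt (by
      rw [minSmoothness_of_isRCLikeNormedField]; exact WithTop.coe_le_coe.2 le_top)
  set d : E := Z.1 - v₂ with hd
  have h5 : fderiv ℝ (fderiv ℝ g) v₂ d = 0 := by
    ext u
    rw [hsymm.eq d u, hd, map_sub, h1 u]
    simp
  -- The Hessian is injective because the derivative of `FL` is, and `(0, d)` is sent to zero.
  have h6 := mfderiv_symm_mfderiv_legendre hΦ hv (0, d)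
  rw [hD d, h5] at h6
  have h7 : ((0, d) : E × E) = 0 := by
    rw [← h6]
    exact map_zero (mfderiv (coModel E) 𝓘(ℝ, E).tangent Φ.symm (legendre L v) :
      E × (E →L[ℝ] ℝ) →L[ℝ] E × E)
  have h8 : d = 0 := congrArg Prod.snd h7
  exact sub_eq_zero.1 h8

lemma hamiltonianField_fst [FiniteDimensional ℝ E]
    (hL : ContMDiff 𝓘(ℝ, E).tangent 𝓘(ℝ, ℝ) ∞ L)
    (hΦ : ∀ v ∈ Φ.source, Φ v = legendre L v) {p : CoTQ E Q} (hp : p ∈ Φ.target) :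
    (hamiltonianField (energy L ∘ Φ.symm) p : E × (E →L[ℝ] ℝ)).1 = (Φ.symm p).2 := by
  -- The point `p` occurs in the types of the vectors; a free `p` with an equation lets `rfl`
  -- replace it where rewriting would be ill-typed.
  have key : ∀ v ∈ Φ.source, ∀ p : CoTQ E Q, legendre L v = p →
      (hamiltonianField (energy L ∘ Φ.symm) p : E × (E →L[ℝ] ℝ)).1 = v.2 := by
    rintro v hv _ rfl
    exact hamiltonianField_legendre_fst hL hΦ hv
  exact key _ (symm_mem_source hp) p (legendre_symm hΦ hp)

lemma mfderiv_symm_hamiltonianField [FiniteDimensional ℝ E]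
    (hL : ContMDiff 𝓘(ℝ, E).tangent 𝓘(ℝ, ℝ) ∞ L)
    (hΦ : ∀ v ∈ Φ.source, Φ v = legendre L v) {p : CoTQ E Q} (hp : p ∈ Φ.target) {v : TQ E Q}
    (hv : v = Φ.symm p) :
    (mfderiv (coModel E) 𝓘(ℝ, E).tangent Φ.symm p (hamiltonianField (energy L ∘ Φ.symm) p) : E × E) =
      lagrangianField L v := by
  have key : ∀ v ∈ Φ.source, ∀ p : CoTQ E Q, legendre L v = p →
      (mfderiv (coModel E) 𝓘(ℝ, E).tangent Φ.symm p (hamiltonianField (energy L ∘ Φ.symm) p) :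
        E × E) = lagrangianField L v := by
    rintro v hv _ rfl
    rw [← mfderiv_legendre_lagrangianField hL hΦ hv]
    exact mfderiv_symm_mfderiv_legendre hΦ hv _
  subst hv
  exact key _ (symm_mem_source hp) p (legendre_symm hΦ hp)

/-- Pulling back `ω_L` by `X` gives `-dα`, where `α = FL ∘ X`. -/
lemma lagrangianForm_mfderiv_eq (hL : ContMDiff 𝓘(ℝ, E).tangent 𝓘(ℝ, ℝ) ∞ L)
    (hΦ : ∀ v ∈ Φ.source, Φ v = legendre L v) {X : ∀ q : Q, TangentSpace 𝓘(ℝ, E) q}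
    {α : ∀ q : Q, CotangentSpace E q} {q : Q}
    (hX : ContMDiffAt 𝓘(ℝ, E) 𝓘(ℝ, E).tangent ∞ (fun q => tPt q (X q)) q)
    (hq : tPt q (X q) ∈ Φ.source)
    (hα : ∀ᶠ z in 𝓝 q, coPt z (α z) = legendre L (tPt z (X z))) (u v : TangentSpace 𝓘(ℝ, E) q) :
    lagrangianForm L (tPt q (X q))
      (mfderiv 𝓘(ℝ, E) 𝓘(ℝ, E).tangent (fun z => tPt z (X z)) q u)
      (mfderiv 𝓘(ℝ, E) 𝓘(ℝ, E).tangent (fun z => tPt z (X z)) q v) =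
    -extDerivOneForm 𝓘(ℝ, E) α q u v := by
  have hF := contMDiffAt_legendre hΦ hq
  have hcomp : ContMDiffAt 𝓘(ℝ, E) (coModel E) ∞ (legendre L ∘ fun z => tPt z (X z)) q :=
    ContMDiffAt.comp q hF hX
  have hαq : ContMDiffAt 𝓘(ℝ, E) (coModel E) ∞ (fun q => coPt q (α q)) q :=
    hcomp.congr_of_eventuallyEq hα
  have hd := HasMFDerivAt.comp q (hF.mdifferentiableAt (by simp)).hasMFDerivAt
    (hX.mdifferentiableAt (by simp)).hasMFDerivAt
  have hd' := (hd.congr_of_eventuallyEq hα).mfderiv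
  rw [extDerivOneForm_eq_canonicalForm hαq, neg_neg, lagrangianForm_eq hL hF]
  -- The two values of `ω` are taken at points equal only by `hα`; passing to the constant
  -- coordinate formula leaves just the tangent vectors to compare.
  refine (canonicalForm_apply _ _ _).trans (Eq.trans ?_ (canonicalForm_apply _ _ _).symm)
  have hw : ∀ w : E, (mfderiv 𝓘(ℝ, E) (coModel E) (fun q => coPt q (α q)) q w :
      E × (E →L[ℝ] ℝ)) = mfderiv 𝓘(ℝ, E).tangent (coModel E) (legendre L) (tPt q (X q))
        (mfderiv 𝓘(ℝ, E) 𝓘(ℝ, E).tangent (fun z => tPt z (X z)) q w) := fun w =>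
    congrArg (fun T : E →L[ℝ] E × (E →L[ℝ] ℝ) => T w) hd'
  rw [hw u, hw v]

/-! ### Passing solutions between the two problems. -/

/-- Take an integral curve `γ` of `X` through `q` and project the velocity of `α ∘ γ` to `Q`: it is
`X q`, and by the second-order condition it is also the vector of `Φ.symm (α q)`. -/
lemma GenHamHJ.eq_symm [FiniteDimensional ℝ E] (hL : ContMDiff 𝓘(ℝ, E).tangent 𝓘(ℝ, ℝ) ∞ L)
    (hΦ : ∀ v ∈ Φ.source, Φ v = legendre L v) {U : Set Q} (hU : IsOpen U)
    {X : ∀ q : Q, TangentSpace 𝓘(ℝ, E) q} {α : ∀ q : Q, CotangentSpace E q}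
    (hα : ∀ q ∈ U, coPt q (α q) ∈ Φ.target) (h : GenHamHJ (energy L ∘ Φ.symm) U X α)
    {q : Q} (hq : q ∈ U) : tPt q (X q) = Φ.symm (coPt q (α q)) := by
  have : CompleteSpace E := FiniteDimensional.complete ℝ E
  have : IsManifold 𝓘(ℝ, E) 1 Q := IsManifold.of_le (n := ∞) (by simp)
  have hX : ContMDiffAt 𝓘(ℝ, E) 𝓘(ℝ, E).tangent 1
      (fun x => (⟨x, X x⟩ : TangentBundle 𝓘(ℝ, E) Q)) q :=
    (h.smooth_field.contMDiffAt (hU.mem_nhds hq)).of_le (by simp)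
  obtain ⟨γ, hγ0, hγ⟩ := exists_isMIntegralCurveAt_of_contMDiffAt_boundaryless 0 hX
  subst hγ0
  have hγc : ContinuousAt γ 0 := hγ.self_of_nhds.continuousAt
  -- Shrink to a ball, an open interval, on which `γ` stays in `U`; the hypothesis speaks only of
  -- such curves.
  obtain ⟨ε, hε, hball⟩ := Metric.eventually_nhds_iff_ball.1
    (hγ.and (hγc.eventually (hU.mem_nhds hq)))
  have h0 : (0 : ℝ) ∈ Metric.ball (0 : ℝ) ε := Metric.mem_ball_self hε
  have hI := h.integral_curves (Metric.ball 0 ε) γ Metric.isOpen_ball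
    (convex_ball (0 : ℝ) ε).ordConnected (fun t ht => (hball t ht).2)
    (fun t ht => (hball t ht).1.hasMFDerivWithinAt) 0 h0
  have hI' := hI.hasMFDerivAt (Metric.isOpen_ball.mem_nhds h0)
  have h1 := HasMFDerivAt.comp (0 : ℝ) (hasMFDerivAt_cotangent_proj (coPt (γ 0) (α (γ 0)))) hI'
  have h2 := hasMFDerivAt_unique h1 hγ.self_of_nhds
  have h3 : (hamiltonianField (energy L ∘ Φ.symm) (coPt (γ 0) (α (γ 0))) : E × (E →L[ℝ] ℝ)).1 =
      X (γ 0) := by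
    have h4 := congrArg (fun T : ℝ →L[ℝ] E => T 1) h2
    have h5 : ((1 : ℝ) • (hamiltonianField (energy L ∘ Φ.symm) (coPt (γ 0) (α (γ 0))) :
      E × (E →L[ℝ] ℝ))).1 = (1 : ℝ) • (X (γ 0) : E) := h4
    rwa [one_smul, one_smul] at h5
  refine tPt_eq_of_eq ?_ ((hamiltonianField_fst hL hΦ (hα _ hq)).symm.trans h3)
  exact congrArg TotalSpace.proj (legendre_symm hΦ (hα _ hq))

lemma GenHamHJ.genLagHJ [FiniteDimensional ℝ E] (hL : ContMDiff 𝓘(ℝ, E).tangent 𝓘(ℝ, ℝ) ∞ L)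
    (hΦ : ∀ v ∈ Φ.source, Φ v = legendre L v) {U : Set Q} (hU : IsOpen U)
    {X : ∀ q : Q, TangentSpace 𝓘(ℝ, E) q} {α : ∀ q : Q, CotangentSpace E q}
    (hα : ∀ q ∈ U, coPt q (α q) ∈ Φ.target) (h : GenHamHJ (energy L ∘ Φ.symm) U X α) :
    GenLagHJ L U X := by
  refine ⟨h.smooth_field, fun I γ hIo hIc hγU hγ t ht => ?_⟩
  have hX : ∀ s ∈ I, tPt (γ s) (X (γ s)) = Φ.symm (coPt (γ s) (α (γ s))) := fun s hs =>
    h.eq_symm hL hΦ hU hα (hγU hs)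
  have hp := hα _ (hγU ht)
  have h1 := h.integral_curves I γ hIo hIc hγU hγ t ht
  have hS := ((contMDiffAt_symm hp).mdifferentiableAt (by simp)).hasMFDerivAt
  -- `X ∘ γ` is `Φ.symm` applied to `α ∘ γ`, so its velocity is the image of `Z_H`, namely `Γ_L`.
  have h2 := (hS.comp_hasMFDerivWithinAt t h1).congr_mono
    (f₁ := fun t => tPt (γ t) (X (γ t))) hX (hX t ht) subset_rfl
  have h3 : (mfderiv (coModel E) 𝓘(ℝ, E).tangent Φ.symm (coPt (γ t) (α (γ t))) :
      E × (E →L[ℝ] ℝ) →L[ℝ] E × E).comp ((1 : ℝ →L[ℝ] ℝ).smulRight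
        (hamiltonianField (energy L ∘ Φ.symm) (coPt (γ t) (α (γ t))) : E × (E →L[ℝ] ℝ))) =
      (1 : ℝ →L[ℝ] ℝ).smulRight (lagrangianField L (tPt (γ t) (X (γ t))) : E × E) := by
    rw [← mfderiv_symm_hamiltonianField hL hΦ hp (hX t ht)]
    exact comp_one_smulRight (G := E × (E →L[ℝ] ℝ)) (G' := E × E) _ _
  exact h3 ▸ h2

lemma GenLagHJ.genHamHJ [FiniteDimensional ℝ E] (hL : ContMDiff 𝓘(ℝ, E).tangent 𝓘(ℝ, ℝ) ∞ L)
    (hΦ : ∀ v ∈ Φ.source, Φ v = legendre L v) {U : Set Q}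
    {X : ∀ q : Q, TangentSpace 𝓘(ℝ, E) q} (hX : ∀ q ∈ U, tPt q (X q) ∈ Φ.source)
    (h : GenLagHJ L U X) :
    GenHamHJ (energy L ∘ Φ.symm) U X (fun q => fiberDeriv L q (X q)) := by
  refine ⟨h.smooth_field, fun q hq => ?_, fun I γ hIo hIc hγU hγ t ht => ?_⟩
  · exact (contMDiffAt_legendre hΦ (hX q hq)).comp_contMDiffWithinAt q (h.smooth_field q hq)
  have hv := hX _ (hγU ht)
  have h1 := h.integral_curves I γ hIo hIc hγU hγ t ht
  have hF := ((contMDiffAt_legendre hΦ hv).mdifferentiableAt (by simp)).hasMFDerivAt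
  have h2 := hF.comp_hasMFDerivWithinAt t h1
  have h3 : (mfderiv 𝓘(ℝ, E).tangent (coModel E) (legendre L) (tPt (γ t) (X (γ t))) :
      E × E →L[ℝ] E × (E →L[ℝ] ℝ)).comp ((1 : ℝ →L[ℝ] ℝ).smulRight
        (lagrangianField L (tPt (γ t) (X (γ t))) : E × E)) =
      (1 : ℝ →L[ℝ] ℝ).smulRight (hamiltonianField (energy L ∘ Φ.symm)
        (legendre L (tPt (γ t) (X (γ t)))) : E × (E →L[ℝ] ℝ)) := by
    rw [← mfderiv_legendre_lagrangianField hL hΦ hv]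
    exact comp_one_smulRight (G := E × E) (G' := E × (E →L[ℝ] ℝ)) _ _
  exact h3 ▸ h2

lemma HamHJ.lagHJ [FiniteDimensional ℝ E] (hL : ContMDiff 𝓘(ℝ, E).tangent 𝓘(ℝ, ℝ) ∞ L)
    (hΦ : ∀ v ∈ Φ.source, Φ v = legendre L v) {U : Set Q} (hU : IsOpen U)
    {X : ∀ q : Q, TangentSpace 𝓘(ℝ, E) q} {α : ∀ q : Q, CotangentSpace E q}
    (hα : ∀ q ∈ U, coPt q (α q) ∈ Φ.target) (h : HamHJ (energy L ∘ Φ.symm) U X α) :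
    LagHJ L U X := by
  have hX : ∀ q ∈ U, tPt q (X q) = Φ.symm (coPt q (α q)) := fun q hq =>
    h.toGenHamHJ.eq_symm hL hΦ hU hα hq
  refine ⟨h.toGenHamHJ.genLagHJ hL hΦ hU hα, fun q hq u v => ?_⟩
  rw [lagrangianForm_mfderiv_eq hL hΦ (α := α) (h.smooth_field.contMDiffAt (hU.mem_nhds hq))
    (hX q hq ▸ symm_mem_source (hα q hq)) ?_, h.closed q hq, neg_zero]
  -- `α = FL ∘ X` holds on the neighbourhood `U` of `q`, as comparing exterior derivatives requires.
  filter_upwards [hU.mem_nhds hq] with z hz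
  rw [hX z hz, legendre_symm hΦ (hα z hz)]

lemma LagHJ.hamHJ [FiniteDimensional ℝ E] (hL : ContMDiff 𝓘(ℝ, E).tangent 𝓘(ℝ, ℝ) ∞ L)
    (hΦ : ∀ v ∈ Φ.source, Φ v = legendre L v) {U : Set Q} (hU : IsOpen U)
    {X : ∀ q : Q, TangentSpace 𝓘(ℝ, E) q} (hX : ∀ q ∈ U, tPt q (X q) ∈ Φ.source)
    (h : LagHJ L U X) :
    HamHJ (energy L ∘ Φ.symm) U X (fun q => fiberDeriv L q (X q)) := by
  refine ⟨h.toGenLagHJ.genHamHJ hL hΦ hX, fun q hq u v => ?_⟩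
  have h1 := lagrangianForm_mfderiv_eq hL hΦ (α := fun q => fiberDeriv L q (X q))
    (h.smooth_field.contMDiffAt (hU.mem_nhds hq)) (hX q hq) (Filter.Eventually.of_forall
      fun _ => rfl) u v
  rw [h.isotropic q hq u v] at h1
  linarith

end HamiltonJacobiCorrespondence

end HamiltonJacobi

end

open HamiltonJacobi

theorem theorem5 {E : Type*} [NormedAddCommGroup E] [NormedSpace ℝ E] [FiniteDimensional ℝ E]
    {Q : Type*} [TopologicalSpace Q] [T2Space Q] [SecondCountableTopology Q]
    [ChartedSpace E Q] [IsManifold 𝓘(ℝ, E) ∞ Q]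
    (L : TQ E Q → ℝ) (hL : ContMDiff 𝓘(ℝ, E).tangent 𝓘(ℝ, ℝ) ∞ L) :
    -- Hyperregular case: `FL` is a diffeomorphism `Φ` and `H = E_L ∘ FL⁻¹` is defined on `T*Q`.
    (∀ Φ : Diffeomorph 𝓘(ℝ, E).tangent (coModel E) (TQ E Q) (CoTQ E Q) ∞,
      (∀ v, Φ v = legendre L v) →
      (∀ (X : ∀ q : Q, TangentSpace 𝓘(ℝ, E) q) (α : ∀ q : Q, CotangentSpace E q),
        (GenHamHJ (energy L ∘ Φ.symm) univ X α →
          (∀ q, tPt q (X q) = Φ.symm (coPt q (α q))) ∧ GenLagHJ L univ X) ∧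
        (HamHJ (energy L ∘ Φ.symm) univ X α →
          (∀ q, tPt q (X q) = Φ.symm (coPt q (α q))) ∧ LagHJ L univ X)) ∧
      (∀ X : ∀ q : Q, TangentSpace 𝓘(ℝ, E) q,
        (GenLagHJ L univ X →
          GenHamHJ (energy L ∘ Φ.symm) univ X (fun q => fiberDeriv L q (X q))) ∧
        (LagHJ L univ X →
          HamHJ (energy L ∘ Φ.symm) univ X (fun q => fiberDeriv L q (X q))))) ∧
    -- Regular case: `FL` is a local diffeomorphism; for every restriction `Φ` of `FL` to an open
    -- set that is a diffeomorphism onto an open set, `H = E_L ∘ Φ⁻¹` is defined on the latter.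
    (IsRegularLagrangian L →
      ∀ Φ : PartialDiffeomorph 𝓘(ℝ, E).tangent (coModel E) (TQ E Q) (CoTQ E Q) ∞,
      (∀ v ∈ Φ.source, Φ v = legendre L v) →
      ∀ U : Set Q, IsOpen U →
      (∀ (X : ∀ q : Q, TangentSpace 𝓘(ℝ, E) q) (α : ∀ q : Q, CotangentSpace E q),
        (∀ q ∈ U, coPt q (α q) ∈ Φ.target) →
        (GenHamHJ (energy L ∘ Φ.symm) U X α →
          (∀ q ∈ U, tPt q (X q) = Φ.symm (coPt q (α q))) ∧ GenLagHJ L U X) ∧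
        (HamHJ (energy L ∘ Φ.symm) U X α →
          (∀ q ∈ U, tPt q (X q) = Φ.symm (coPt q (α q))) ∧ LagHJ L U X)) ∧
      (∀ X : ∀ q : Q, TangentSpace 𝓘(ℝ, E) q,
        (∀ q ∈ U, tPt q (X q) ∈ Φ.source) →
        (GenLagHJ L U X →
          GenHamHJ (energy L ∘ Φ.symm) U X (fun q => fiberDeriv L q (X q))) ∧
        (LagHJ L U X →
          HamHJ (energy L ∘ Φ.symm) U X (fun q => fiberDeriv L q (X q))))) := by
  have core : ∀ Φ : PartialDiffeomorph 𝓘(ℝ, E).tangent (coModel E) (TQ E Q) (CoTQ E Q) ∞,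
      (∀ v ∈ Φ.source, Φ v = legendre L v) →
      ∀ U : Set Q, IsOpen U →
      (∀ (X : ∀ q : Q, TangentSpace 𝓘(ℝ, E) q) (α : ∀ q : Q, CotangentSpace E q),
        (∀ q ∈ U, coPt q (α q) ∈ Φ.target) →
        (GenHamHJ (energy L ∘ Φ.symm) U X α →
          (∀ q ∈ U, tPt q (X q) = Φ.symm (coPt q (α q))) ∧ GenLagHJ L U X) ∧
        (HamHJ (energy L ∘ Φ.symm) U X α →
          (∀ q ∈ U, tPt q (X q) = Φ.symm (coPt q (α q))) ∧ LagHJ L U X)) ∧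
      (∀ X : ∀ q : Q, TangentSpace 𝓘(ℝ, E) q,
        (∀ q ∈ U, tPt q (X q) ∈ Φ.source) →
        (GenLagHJ L U X →
          GenHamHJ (energy L ∘ Φ.symm) U X (fun q => fiberDeriv L q (X q))) ∧
        (LagHJ L U X →
          HamHJ (energy L ∘ Φ.symm) U X (fun q => fiberDeriv L q (X q)))) :=
    fun Φ hΦ U hU =>
      ⟨fun X α hα =>
        ⟨fun h => ⟨fun q hq => h.eq_symm hL hΦ hU hα hq, h.genLagHJ hL hΦ hU hα⟩,
          fun h => ⟨fun q hq => h.toGenHamHJ.eq_symm hL hΦ hU hα hq, h.lagHJ hL hΦ hU hα⟩⟩,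
        fun X hX => ⟨fun h => h.genHamHJ hL hΦ hX, fun h => h.hamHJ hL hΦ hU hX⟩⟩
  refine ⟨fun Φ hΦ => ?_, fun _ => core⟩
  -- The hyperregular case is the local one with source, target and `U` all equal to the whole
  -- space, so the membership conditions are trivial.
  obtain ⟨h1, h2⟩ := core Φ.toPartialDiffeomorph (fun v _ => hΦ v) univ isOpen_univ
  refine ⟨fun X α => ?_, fun X => h2 X fun _ _ => mem_univ _⟩
  obtain ⟨h3, h4⟩ := h1 X α fun _ _ => mem_univ _
  exact ⟨fun h => ⟨fun q => (h3 h).1 q (mem_univ q), (h3 h).2⟩,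
    fun h => ⟨fun q => (h4 h).1 q (mem_univ q), (h4 h).2⟩⟩
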